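/- Let $\mathbb K$ be any field and let $n\ge 2$, $d\ge 1$ be integers. Let $C_{\mathbb K}(n)$ be the unital associative $\mathbb K$-algebra with generators $x_1,\dots,x_n,y_1,\dots,y_n$ and relations $y_ix_j=\delta_{i,j}1$ for $1\le i,j\le n$, and let the Leavitt algebra $L_{\mathbb K}(n)$ be the quotient of $C_{\mathbb K}(n)$ by the two-sided ideal generated by $1-\sum_{i=1}^n x_iy_i$. Let $S=M_d(L_{\mathbb K}(n))$ be the algebra of $d\times d$ matrices over $L_{\mathbb K}(n)$, let $S^-$ be $S$ regarded as a Lie algebra over $\mathbb K$ with bracket $[a,b]=ab-ba$, and let $[S^-,S^-]$ be the Lie subalgebra of $S^-$ consisting of all finite sums of elements $[a,b]$ with $a,b\in S$. A Lie algebra $\mathfrak L$ over $\mathbb K$ is called simple if $[\mathfrak L,\mathfrak L]\ne\{0\}$ and its only ideals are $\{0\}$ and $\mathfrak L$. Then $[S^-,S^-]$ is a simple Lie algebra if and only if $\operatorname{char}(\mathbb K)$ divides $n-1$ and $\operatorname{char}(\mathbb K)$ does not divide $d$. (When $\operatorname{char}(\mathbb K)=0$, it divides only the integer $0$; so $[S^-,S^-]$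 is then not simple.) -/

import Mathlib

attribute [local instance 100] LieRing.ofAssociativeRing

/-- The defining relations `y i * x j = δ i j` of the Cohn algebra, imposed on the free unital
associative `K`-algebra on the letters `x i = ι (Sum.inl i)` and `y i = ι (Sum.inr i)`. -/
inductive CohnRel (K : Type*) [Field K] (n : ℕ) :
    FreeAlgebra K (Fin n ⊕ Fin n) → FreeAlgebra K (Fin n ⊕ Fin n) → Prop
  | y_mul_x (i j : Fin n) :
      CohnRel K n (FreeAlgebra.ι K (Sum.inr i) * FreeAlgebra.ι K (Sum.inl j))
        (if i = j then 1 else 0)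

/-- The Cohn `K`-algebra of order `n`: the unital associative `K`-algebra with generators
`x i`, `y i` and relations `y i * x j = δ i j`. -/
def CohnAlgebra (K : Type*) [Field K] (n : ℕ) : Type _ :=
  RingQuot (CohnRel K n)

namespace CohnAlgebra

instance (K : Type*) [Field K] (n : ℕ) : Ring (CohnAlgebra K n) :=
  inferInstanceAs (Ring (RingQuot (CohnRel K n)))

instance (K : Type*) [Field K] (n : ℕ) : Algebra K (CohnAlgebra K n) :=
  inferInstanceAs (Algebra K (RingQuot (CohnRel K n)))

/-- The generator `x i` of the Cohn algebra. -/
def x (K : Type*) [Field K] {n : ℕ} (i : Fin n) : CohnAlgebra K n :=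
  RingQuot.mkAlgHom K (CohnRel K n) (FreeAlgebra.ι K (Sum.inl i))

/-- The generator `y i` of the Cohn algebra. -/
def y (K : Type*) [Field K] {n : ℕ} (i : Fin n) : CohnAlgebra K n :=
  RingQuot.mkAlgHom K (CohnRel K n) (FreeAlgebra.ι K (Sum.inr i))

/-- The two-sided ideal of the Cohn algebra generated by `1 - ∑ i, x i * y i`. -/
def leavittIdeal (K : Type*) [Field K] (n : ℕ) : TwoSidedIdeal (CohnAlgebra K n) :=
  TwoSidedIdeal.span {1 - ∑ i : Fin n, x K i * y K i}

end CohnAlgebra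

/-- The Leavitt `K`-algebra of order `n`: the quotient of the Cohn algebra by the two-sided ideal
generated by `1 - ∑ i, x i * y i`. -/
def LeavittAlgebra (K : Type*) [Field K] (n : ℕ) : Type _ :=
  (CohnAlgebra.leavittIdeal K n).ringCon.Quotient

namespace LeavittAlgebra

instance (K : Type*) [Field K] (n : ℕ) : Ring (LeavittAlgebra K n) :=
  inferInstanceAs (Ring (CohnAlgebra.leavittIdeal K n).ringCon.Quotient)

instance (K : Type*) [Field K] (n : ℕ) : Algebra K (LeavittAlgebra K n) :=
  inferInstanceAs (Algebra K (CohnAlgebra.leavittIdeal K n).ringCon.Quotient)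

end LeavittAlgebra

/-- For an associative `K`-algebra `S`, with Lie bracket `⁅a, b⁆ = a * b - b * a`, the derived Lie
algebra `[S⁻, S⁻]`: the `K`-span of all brackets `⁅a, b⁆` (equivalently, the set of their finite
sums), a Lie ideal of `S⁻` and hence itself a Lie algebra over `K`. -/
abbrev commutatorLie (K S : Type*) [Field K] [Ring S] [Algebra K S] : LieIdeal K S :=
  ⁅(⊤ : LieIdeal K S), (⊤ : LieIdeal K S)⁆

/-!
Write `L` for the Leavitt algebra and `S` for the algebra of `d × d` matrices over it.

If `[S⁻, S⁻]` is simple, it does not contain `1`: otherwise `K ∙ 1` would be a nonzero central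
ideal, hence everything, and `[S⁻, S⁻]` would be abelian.
But `n - 1 = ∑ i, [y i, x i]` is a sum of commutators, and so is the identity matrix as soon as
`d = 0` in `K`, being congruent to `d` times a diagonal matrix unit. This gives both divisibility
conditions.

For the converse, suppose `n = 1` and `d ≠ 0` in `K`. Two facts about `L` are needed.

* `L` has a trace with value `1` at `1` (`LeavittAlgebra.exists_trace`). On the Cohn algebra, which
  acts on the space with basis its monomials `x_I y_J`, the functional `x_I y_J ↦ δ_{I,J}` is a
  trace; it vanishes on the ideal generated by `1 - ∑ i, x i * y i` because its value at the product
  of a monomial with this generator is `0` or `1 - n = 0`. Composing with the matrix trace gives a functional that kills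
  `[S⁻, S⁻]` but takes the value `d ≠ 0` at `1`, so `1 ∉ [S⁻, S⁻]`.
* `L`, and hence `S`, is a simple ring (`LeavittFamily.isSimpleRing`). A nonzero element times a
  long word in the `x i` is a nonzero noncommutative polynomial in the `x i`; stripping a shortest
  word from it makes the constant term nonzero, and sandwiching between a word `x i ^ m * x j` and
  its left inverse kills everything but that constant term.

The remaining argument is about any simple ring `S` with elements `x i`, `y i`, at least four of
each, satisfying the relations of a Leavitt algebra; words of length two in the generators supply
them here. The elements `x i * a * y j` multiply like matrix units with coefficients in `S`, so that
`S` behaves like a matrix algebra over itself. Take `u ≠ 0` in a Lie ideal of `[S⁻, S⁻]`. If `u` has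
a nonzero off-diagonal entry, or is diagonal but not a central scalar, then brackets with
off-diagonal units produce a nonzero off-diagonal unit in the ideal
(`LeavittFamily.exists_unit_mem`). If `u` is central, it is invertible in the centre, and
`1 ∈ [S⁻, S⁻]`, which was excluded. By simplicity of `S` one nonzero off-diagonal unit yields all of
them (`LeavittFamily.units_mem_of_unit_mem`), and their brackets span `[S⁻, S⁻]`
(`LeavittFamily.lie_mem_of_units_mem`). No assumption on the characteristic enters, and the centre
of `S` need not be computed.
-/

/-! ### Words in families with `y i * x j = δ i j` -/

/-- The monomial `x i₁ * ⋯ * x iₖ` of the word `[i₁, …, iₖ]`. -/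
def wordX {ι A : Type*} [Ring A] (x : ι → A) (I : List ι) : A := (I.map x).prod

/-- The monomial `y iₖ * ⋯ * y i₁` of the word `[i₁, …, iₖ]`. The letters are read backwards, so
that `y i * x j = δ i j` makes `wordY y I` a left inverse of `wordX x I`. -/
def wordY {ι A : Type*} [Ring A] (y : ι → A) (I : List ι) : A := (I.reverse.map y).prod

section Words

variable {ι A : Type*} [Ring A] {x y : ι → A}

@[simp] lemma wordX_nil : wordX x [] = 1 := rfl

@[simp] lemma wordY_nil : wordY y [] = 1 := rfl

lemma wordX_cons (i : ι) (I : List ι) : wordX x (i :: I) = x i * wordX x I := by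
  simp [wordX]

lemma wordY_cons (i : ι) (I : List ι) : wordY y (i :: I) = wordY y I * y i := by
  simp [wordY]

lemma wordX_append (I J : List ι) : wordX x (I ++ J) = wordX x I * wordX x J := by
  simp [wordX]

lemma wordY_append_singleton (I : List ι) (i : ι) : wordY y (I ++ [i]) = y i * wordY y I := by
  simp [wordY]

variable [DecidableEq ι]

lemma wordY_mul_wordX_self (h : ∀ i j, y i * x j = if i = j then 1 else 0) (I : List ι) :
    wordY y I * wordX x I = 1 := by
  induction I with
  | nil => simp
  | cons i I ih =>
    rw [wordY_cons, wordX_cons, mul_assoc, ← mul_assoc (y i), h, if_pos rfl, one_mul, ih]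

/-- If `J` is at least as long as `I`, then `wordY y I` either strips `I` from `wordX x J` or
annihilates it. -/
lemma wordY_mul_wordX (h : ∀ i j, y i * x j = if i = j then 1 else 0) (I J : List ι)
    (hIJ : I.length ≤ J.length) :
    wordY y I * wordX x J = 0 ∨ ∃ J', J = I ++ J' ∧ wordY y I * wordX x J = wordX x J' := by
  induction I generalizing J with
  | nil => exact Or.inr ⟨J, by simp⟩
  | cons i I ih =>
    cases J with
    | nil => simp at hIJ
    | cons j J =>
      have e : wordY y (i :: I) * wordX x (j :: J)
          = if i = j then wordY y I * wordX x J else 0 := by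
        rw [wordY_cons, wordX_cons, mul_assoc, ← mul_assoc (y i), h]
        split_ifs <;> simp
      rw [e]
      split_ifs with hij
      · subst hij
        rcases ih J (by simpa using hIJ) with h0 | ⟨J', hJ, hJ'⟩
        · exact Or.inl h0
        · exact Or.inr ⟨J', by simp [hJ], hJ'⟩
      · exact Or.inl rfl

/-- The monomials `wordX x I * wordY y J` span the algebra generated by the two families. -/
lemma span_wordX_mul_wordY {K : Type*} [Field K] [Algebra K A]
    (h : ∀ i j, y i * x j = if i = j then 1 else 0)
    (hgen : Algebra.adjoin K (Set.range x ∪ Set.range y) = ⊤) :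
    Submodule.span K (Set.range fun p : List ι × List ι => wordX x p.1 * wordY y p.2) = ⊤ := by
  set M := Submodule.span K (Set.range fun p : List ι × List ι => wordX x p.1 * wordY y p.2)
  have hmem (I J : List ι) : wordX x I * wordY y J ∈ M := Submodule.subset_span ⟨(I, J), rfl⟩
  have key : ∀ a ∈ Algebra.adjoin K (Set.range x ∪ Set.range y), ∀ m ∈ M, a * m ∈ M := by
    intro a ha
    induction ha using Algebra.adjoin_induction with
    | mem a ha =>
      intro m hm
      induction hm using Submodule.span_induction with
      | mem m hm =>
        obtain ⟨⟨I, J⟩, rfl⟩ := hm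
        rcases ha with ⟨i, rfl⟩ | ⟨i, rfl⟩
        · simpa [wordX_cons, mul_assoc] using hmem (i :: I) J
        · cases I with
          | nil => simpa [wordY_append_singleton] using hmem [] (J ++ [i])
          | cons j I =>
            simp only [wordX_cons]
            rw [← mul_assoc, ← mul_assoc, h]
            split_ifs
            · simpa using hmem I J
            · simp
      | zero => simp
      | add m m' _ _ hm hm' => rw [mul_add]; exact add_mem hm hm'
      | smul c m _ hm => rw [mul_smul_comm]; exact M.smul_mem c hm
    | algebraMap c => intro m hm; rw [← Algebra.smul_def]; exact M.smul_mem c hm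
    | add a b _ _ ha hb => intro m hm; rw [add_mul]; exact add_mem (ha m hm) (hb m hm)
    | mul a b _ _ ha hb => intro m hm; rw [mul_assoc]; exact ha _ (hb m hm)
  refine eq_top_iff.2 fun a _ => ?_
  have := key a (by rw [hgen]; trivial) 1 (by simpa using hmem [] [])
  rwa [mul_one] at this

end Words

/-! ### Leavitt families -/

/-- Families `x`, `y` of elements of a ring satisfying the relations `y i * x j = δ i j` and
`∑ i, x i * y i = 1` of a Leavitt algebra. -/
structure LeavittFamily {ι A : Type*} [Fintype ι] [DecidableEq ι] [Ring A] (x y : ι → A) :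
    Prop where
  mul_eq (i j : ι) : y i * x j = if i = j then 1 else 0
  sum_eq : ∑ i, x i * y i = 1

namespace LeavittFamily

variable {ι A : Type*} [Fintype ι] [DecidableEq ι] [Ring A] {x y : ι → A}

lemma mul_self (h : LeavittFamily x y) (i : ι) : y i * x i = 1 := by simp [h.mul_eq]

lemma mul_ne (h : LeavittFamily x y) {i j : ι} (hij : i ≠ j) : y i * x j = 0 := by
  simp [h.mul_eq, hij]

lemma map {B : Type*} [Ring B] (h : LeavittFamily x y) (f : A →+* B) :
    LeavittFamily (fun i => f (x i)) (fun i => f (y i)) where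
  mul_eq i j := by
    rw [← map_mul, h.mul_eq]
    split_ifs <;> simp
  sum_eq := by simp only [← map_mul, ← map_sum, h.sum_eq, map_one]

/-- The monomials of length two again form a Leavitt family. -/
lemma prod (h : LeavittFamily x y) :
    LeavittFamily (fun p : ι × ι => x p.1 * x p.2) (fun p : ι × ι => y p.2 * y p.1) where
  mul_eq := by
    rintro ⟨i, j⟩ ⟨k, l⟩
    rw [mul_assoc, ← mul_assoc (y i), h.mul_eq]
    by_cases hik : i = k <;> simp [hik, h.mul_eq]
  sum_eq := by
    rw [Fintype.sum_prod_type]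
    have (i : ι) : ∑ j, x i * x j * (y j * y i) = x i * y i := by
      calc ∑ j, x i * x j * (y j * y i) = x i * (∑ j, x j * y j) * y i := by
            simp only [Finset.mul_sum, Finset.sum_mul, mul_assoc]
        _ = x i * y i := by rw [h.sum_eq, mul_one]
    simp only [this, h.sum_eq]

lemma ext_right (h : LeavittFamily x y) {a b : A} (hab : ∀ i, a * x i = b * x i) : a = b := by
  rw [← mul_one a, ← mul_one b, ← h.sum_eq, Finset.mul_sum, Finset.mul_sum]
  exact Finset.sum_congr rfl fun i _ => by rw [← mul_assoc, hab, mul_assoc]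

lemma ext_left (h : LeavittFamily x y) {a b : A} (hab : ∀ i, y i * a = y i * b) : a = b := by
  rw [← one_mul a, ← one_mul b, ← h.sum_eq, Finset.sum_mul, Finset.sum_mul]
  exact Finset.sum_congr rfl fun i _ => by rw [mul_assoc, hab, mul_assoc]

lemma exists_mul_wordX_ne_zero (h : LeavittFamily x y) (k : ℕ) {a : A} (ha : a ≠ 0) :
    ∃ J : List ι, J.length = k ∧ a * wordX x J ≠ 0 := by
  induction k generalizing a with
  | zero => exact ⟨[], rfl, by simpa using ha⟩
  | succ k ih =>
    obtain ⟨i, hi⟩ : ∃ i, a * x i ≠ 0 := by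
      by_contra! h0
      exact ha (h.ext_right (by simpa using h0))
    obtain ⟨J, hJ, hne⟩ := ih hi
    exact ⟨i :: J, by simp [hJ], by rwa [wordX_cons, ← mul_assoc]⟩

/-- Multiplying on the right by long words in `x` clears all `y`'s. -/
lemma exists_mul_wordX_mem_span {K : Type*} [Field K] [Algebra K A] (h : LeavittFamily x y)
    (hgen : Algebra.adjoin K (Set.range x ∪ Set.range y) = ⊤) (a : A) :
    ∃ k, ∀ J : List ι, k ≤ J.length → a * wordX x J ∈ Submodule.span K (Set.range (wordX x)) := by
  have ha : a ∈ Submodule.span K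
      (Set.range fun p : List ι × List ι => wordX x p.1 * wordY y p.2) := by
    rw [span_wordX_mul_wordY h.mul_eq hgen]; trivial
  induction ha using Submodule.span_induction with
  | mem a ha =>
    obtain ⟨⟨I, L⟩, rfl⟩ := ha
    refine ⟨L.length, fun J hJ => ?_⟩
    simp only [mul_assoc]
    rcases wordY_mul_wordX h.mul_eq L J hJ with h0 | ⟨J', -, hJ'⟩
    · simp [h0]
    · rw [hJ', ← wordX_append]
      exact Submodule.subset_span ⟨_, rfl⟩
  | zero => exact ⟨0, by simp⟩
  | add a b _ _ ha hb =>
    obtain ⟨k, hk⟩ := ha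
    obtain ⟨l, hl⟩ := hb
    refine ⟨max k l, fun J hJ => ?_⟩
    rw [add_mul]
    exact add_mem (hk J (le_trans (le_max_left _ _) hJ)) (hl J (le_trans (le_max_right _ _) hJ))
  | smul c a _ ha =>
    obtain ⟨k, hk⟩ := ha
    exact ⟨k, fun J hJ => by rw [smul_mul_assoc]; exact Submodule.smul_mem _ c (hk J hJ)⟩

lemma pow_mul_pow (h : LeavittFamily x y) (i : ι) (a b : ℕ) : y i ^ a * x i ^ (a + b) = x i ^ b := by
  induction a with
  | zero => simp
  | succ a ih =>
    rw [pow_succ, add_right_comm, pow_succ', mul_assoc, ← mul_assoc (y i), h.mul_self, one_mul, ih]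

lemma pow_mul_wordX (h : LeavittFamily x y) (i : ι) (I : List ι) (m : ℕ) (hm : I.length ≤ m) :
    y i ^ m * wordX x I = 0 ∨ y i ^ m * wordX x I = y i ^ (m - I.length) := by
  induction I generalizing m with
  | nil => simp
  | cons j I ih =>
    obtain ⟨m, rfl⟩ : ∃ m', m = m' + 1 := ⟨m - 1, by simp at hm; omega⟩
    rw [wordX_cons, pow_succ, mul_assoc, ← mul_assoc (y i), h.mul_eq]
    split_ifs
    · simpa using ih m (by simpa using hm)
    · simp

/-- No word `x i ^ m * x j` with `i ≠ j` overlaps itself after a shift by at most `m`, so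
sandwiching between it and its left inverse kills all nonempty words of length at most `m`. -/
lemma sandwich_wordX (h : LeavittFamily x y) {i j : ι} (hij : i ≠ j) {I : List ι} (hI : I ≠ [])
    {m : ℕ} (hm : I.length ≤ m) : y j * y i ^ m * wordX x I * (x i ^ m * x j) = 0 := by
  rw [mul_assoc (y j)]
  rcases h.pow_mul_wordX i I m hm with h0 | h0 <;> rw [h0]
  · simp
  obtain ⟨k, hk⟩ : ∃ k, I.length = k + 1 := ⟨I.length - 1, by
    have := List.length_pos_iff.2 hI; omega⟩
  obtain ⟨b, rfl⟩ := Nat.exists_eq_add_of_le hm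
  rw [Nat.add_sub_cancel_left, add_comm, mul_assoc, ← mul_assoc _ (x i ^ _), h.pow_mul_pow, hk,
    pow_succ', mul_assoc, ← mul_assoc, h.mul_ne hij.symm, zero_mul]

lemma sandwich_one (h : LeavittFamily x y) (i j : ι) (m : ℕ) :
    y j * y i ^ m * (x i ^ m * x j) = 1 := by
  have := h.pow_mul_pow i m 0
  rw [add_zero, pow_zero] at this
  rw [mul_assoc, ← mul_assoc _ (x i ^ m), this, one_mul, h.mul_self]

/-- Every nonzero element of an algebra generated by a Leavitt family divides `1` in a two-sided
sense. -/
lemma exists_mul_mul_eq_one {K : Type*} [Field K] [Algebra K A] [Nontrivial ι]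
    (h : LeavittFamily x y) (hgen : Algebra.adjoin K (Set.range x ∪ Set.range y) = ⊤) {a : A}
    (ha : a ≠ 0) : ∃ u v, u * a * v = 1 := by
  obtain ⟨k, hk⟩ := h.exists_mul_wordX_mem_span hgen a
  obtain ⟨J, hJ, hne⟩ := h.exists_mul_wordX_ne_zero k ha
  obtain ⟨f, hf⟩ := Finsupp.mem_span_range_iff_exists_finsupp.1 (hk J hJ.ge)
  have hf0 : f.support.Nonempty := by
    rw [Finsupp.support_nonempty_iff]
    rintro rfl
    exact hne (by simp [← hf])
  -- A shortest word `I₀` of the polynomial `a * wordX x J` becomes its constant term.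
  obtain ⟨I₀, hI₀, hmin⟩ := f.support.exists_min_image List.length hf0
  obtain ⟨i, j, hij⟩ := exists_pair_ne ι
  set m := f.support.sup List.length
  have key : y j * y i ^ m * wordY y I₀ * (a * wordX x J) * (x i ^ m * x j)
      = algebraMap K A (f I₀) := by
    rw [← hf, Finsupp.sum, Finset.mul_sum, Finset.sum_mul, Finset.sum_eq_single I₀]
    · rw [mul_smul_comm, smul_mul_assoc, mul_assoc _ (wordY y I₀), wordY_mul_wordX_self h.mul_eq,
        mul_one, h.sandwich_one, Algebra.algebraMap_eq_smul_one]
    · intro I hI hne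
      rw [mul_smul_comm, smul_mul_assoc, mul_assoc _ (wordY y I₀)]
      rcases wordY_mul_wordX h.mul_eq I₀ I (hmin I hI) with h0 | ⟨I', hI', e⟩
      · simp [h0]
      · have hlen : I.length ≤ m := Finset.le_sup (f := List.length) hI
        rw [e, h.sandwich_wordX hij (by rintro rfl; simp at hI'; exact hne hI')
          (by rw [hI'] at hlen; simp at hlen; omega), smul_zero]
    · intro hn; exact absurd hI₀ hn
  refine ⟨algebraMap K A (f I₀)⁻¹ * (y j * y i ^ m * wordY y I₀),
    wordX x J * (x i ^ m * x j), ?_⟩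
  rw [mul_assoc, mul_assoc, ← mul_assoc a, ← mul_assoc (y j * y i ^ m * wordY y I₀), key,
    ← map_mul, inv_mul_cancel₀ (Finsupp.mem_support_iff.1 hI₀), map_one]

/-- A nontrivial algebra generated by a Leavitt family with at least two members is simple. -/
lemma isSimpleRing {K : Type*} [Field K] [Algebra K A] [Nontrivial ι] [Nontrivial A]
    (h : LeavittFamily x y) (hgen : Algebra.adjoin K (Set.range x ∪ Set.range y) = ⊤) :
    IsSimpleRing A := by
  refine IsSimpleRing.of_eq_bot_or_eq_top fun I => or_iff_not_imp_left.2 fun hI => ?_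
  obtain ⟨a, ha, ha0⟩ : ∃ a ∈ I, a ≠ 0 := by
    by_contra! h0
    exact hI (le_bot_iff.1 fun a ha => (TwoSidedIdeal.mem_bot _).2 (h0 a ha))
  obtain ⟨u, v, huv⟩ := h.exists_mul_mul_eq_one hgen ha0
  exact I.one_mem_iff.1 (huv ▸ I.mul_mem_right _ _ (I.mul_mem_left _ _ ha))

end LeavittFamily

/-! ### The trace of the Leavitt algebra -/

namespace CohnAlgebra

variable (K : Type*) [Field K] {n : ℕ}

lemma y_mul_x (i j : Fin n) : y K i * x K j = if i = j then 1 else 0 := by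
  have := RingQuot.mkAlgHom_rel K (CohnRel.y_mul_x (K := K) i j)
  rw [map_mul] at this
  refine this.trans ?_
  split_ifs
  · exact map_one _
  · exact map_zero _

lemma adjoin_eq_top : Algebra.adjoin K (Set.range (x K (n := n)) ∪ Set.range (y K)) = ⊤ := by
  have h : (RingQuot.mkAlgHom K (CohnRel K n)).range = ⊤ :=
    AlgHom.range_eq_top _ |>.2 (RingQuot.mkAlgHom_surjective K _)
  refine eq_top_iff.2 (h.symm.le.trans ?_)
  rw [← Algebra.map_top, ← FreeAlgebra.adjoin_range_ι, AlgHom.map_adjoin]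
  refine Algebra.adjoin_mono ?_
  rintro _ ⟨_, ⟨i | i, rfl⟩, rfl⟩
  · exact Or.inl ⟨i, rfl⟩
  · exact Or.inr ⟨i, rfl⟩

/-- Left multiplication by a generator on the vector space whose basis element `(I, J)` stands for
the monomial `wordX x I * wordY y J`. -/
noncomputable def generatorAction (n : ℕ) :
    Fin n ⊕ Fin n → Module.End K (List (Fin n) × List (Fin n) →₀ K)
  | Sum.inl i => Finsupp.linearCombination K fun p => Finsupp.single (i :: p.1, p.2) 1
  | Sum.inr i => Finsupp.linearCombination K fun p =>
      match p.1 with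
      | [] => Finsupp.single ([], p.2 ++ [i]) 1
      | j :: I => if i = j then Finsupp.single (I, p.2) 1 else 0

/-- The left regular representation of the Cohn algebra in coordinates: `(I, J)` stands for the
monomial `wordX x I * wordY y J`. -/
noncomputable def regularRep (n : ℕ) :
    CohnAlgebra K n →ₐ[K] Module.End K (List (Fin n) × List (Fin n) →₀ K) :=
  RingQuot.liftAlgHom K ⟨FreeAlgebra.lift K (generatorAction K n), by
    rintro _ _ ⟨i, j⟩
    rw [map_mul, FreeAlgebra.lift_ι_apply, FreeAlgebra.lift_ι_apply]
    ext p : 2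
    by_cases hij : i = j <;> simp [generatorAction, hij]⟩

lemma regularRep_x (i : Fin n) (I J : List (Fin n)) :
    regularRep K n (x K i) (Finsupp.single (I, J) 1) = Finsupp.single (i :: I, J) 1 := by
  have : regularRep K n (x K i) = generatorAction K n (Sum.inl i) :=
    (RingQuot.liftAlgHom_mkAlgHom_apply ..).trans (FreeAlgebra.lift_ι_apply ..)
  simp [this, generatorAction]

lemma regularRep_y (i : Fin n) (J : List (Fin n)) :
    regularRep K n (y K i) (Finsupp.single ([], J) 1) = Finsupp.single ([], J ++ [i]) 1 := by
  have : regularRep K n (y K i) = generatorAction K n (Sum.inr i) :=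
    (RingQuot.liftAlgHom_mkAlgHom_apply ..).trans (FreeAlgebra.lift_ι_apply ..)
  simp [this, generatorAction]

lemma regularRep_wordY (J L : List (Fin n)) :
    regularRep K n (wordY (y K) J) (Finsupp.single ([], L) 1) = Finsupp.single ([], L ++ J) 1 := by
  induction J generalizing L with
  | nil => simp
  | cons j J ih => simp [wordY_cons, regularRep_y, ih]

lemma regularRep_wordX_mul_wordY (I J : List (Fin n)) :
    regularRep K n (wordX (x K) I * wordY (y K) J) (Finsupp.single ([], []) 1)
      = Finsupp.single (I, J) 1 := by
  induction I with
  | nil => simp [regularRep_wordY]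
  | cons i I ih => rw [wordX_cons, mul_assoc, map_mul, Module.End.mul_apply, ih, regularRep_x]

/-- The trace of the Cohn algebra: the linear functional taking the value `1` at the monomials
`wordX x I * wordY y I` and `0` at `wordX x I * wordY y J` for `I ≠ J`. -/
noncomputable def trace (n : ℕ) : CohnAlgebra K n →ₗ[K] K :=
  (Finsupp.linearCombination K fun p : List (Fin n) × List (Fin n) =>
      if p.1 = p.2 then (1 : K) else 0) ∘ₗ
    LinearMap.applyₗ (Finsupp.single ([], []) 1) ∘ₗ (regularRep K n).toLinearMap

lemma trace_wordX_mul_wordY (I J : List (Fin n)) :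
    trace K n (wordX (x K) I * wordY (y K) J) = if I = J then 1 else 0 := by
  simp only [trace, LinearMap.comp_apply, AlgHom.toLinearMap_apply, LinearMap.applyₗ_apply_apply]
  rw [regularRep_wordX_mul_wordY, Finsupp.linearCombination_single, one_smul]

lemma trace_one : trace K n 1 = 1 := by
  simpa using trace_wordX_mul_wordY K (n := n) [] []

/-- Linear functionals on the Cohn algebra agree if they agree on the monomials. -/
lemma linearMap_ext {f g : CohnAlgebra K n →ₗ[K] K}
    (h : ∀ I J, f (wordX (x K) I * wordY (y K) J) = g (wordX (x K) I * wordY (y K) J)) :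
    f = g :=
  LinearMap.ext_on (span_wordX_mul_wordY (y_mul_x K) (adjoin_eq_top K)) (by
    rintro _ ⟨⟨I, J⟩, rfl⟩
    exact h I J)

lemma trace_x_mul (i : Fin n) (b : CohnAlgebra K n) :
    trace K n (x K i * b) = trace K n (b * x K i) := by
  suffices trace K n ∘ₗ LinearMap.mulLeft K (x K i) = trace K n ∘ₗ LinearMap.mulRight K (x K i) from
    LinearMap.congr_fun this b
  refine linearMap_ext K fun I J => ?_
  simp only [LinearMap.comp_apply, LinearMap.mulLeft_apply, LinearMap.mulRight_apply]
  rw [← mul_assoc, ← wordX_cons, trace_wordX_mul_wordY]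
  cases J with
  | nil =>
    have := trace_wordX_mul_wordY K (I ++ [i]) []
    simp only [wordX_append, wordX_cons, wordX_nil, wordY_nil, mul_one] at this
    simp [this]
  | cons j J =>
    rw [wordY_cons, mul_assoc, mul_assoc, y_mul_x]
    by_cases hij : j = i
    · simp [hij, trace_wordX_mul_wordY]
    · simp [hij, Ne.symm hij]

lemma trace_y_mul (i : Fin n) (b : CohnAlgebra K n) :
    trace K n (y K i * b) = trace K n (b * y K i) := by
  suffices trace K n ∘ₗ LinearMap.mulLeft K (y K i) = trace K n ∘ₗ LinearMap.mulRight K (y K i) from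
    LinearMap.congr_fun this b
  refine linearMap_ext K fun I J => ?_
  simp only [LinearMap.comp_apply, LinearMap.mulLeft_apply, LinearMap.mulRight_apply]
  rw [mul_assoc, ← wordY_cons, trace_wordX_mul_wordY]
  cases I with
  | nil => simpa [wordY_append_singleton] using trace_wordX_mul_wordY K [] (J ++ [i])
  | cons j I =>
    rw [wordX_cons, ← mul_assoc, ← mul_assoc, y_mul_x]
    by_cases hij : i = j
    · simp [hij, trace_wordX_mul_wordY]
    · simp [hij, Ne.symm hij]

lemma trace_mul_comm (a b : CohnAlgebra K n) : trace K n (a * b) = trace K n (b * a) := by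
  have ha : a ∈ Algebra.adjoin K (Set.range (x K (n := n)) ∪ Set.range (y K)) := by
    rw [adjoin_eq_top]; trivial
  induction ha using Algebra.adjoin_induction generalizing b with
  | mem a ha =>
    rcases ha with ⟨i, rfl⟩ | ⟨i, rfl⟩
    · exact trace_x_mul K i b
    · exact trace_y_mul K i b
  | algebraMap c => rw [Algebra.commutes]
  | add a a' _ _ ha ha' => rw [add_mul, mul_add, map_add, map_add, ha, ha']
  | mul a a' _ _ ha ha' => rw [mul_assoc, ha, mul_assoc, ha', mul_assoc]

/-- When `n = 1` in `K`, the trace vanishes on the ideal defining the Leavitt algebra: on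
`wordX x I * (1 - ∑ i, x i * y i)` it takes the value `1 - n` for empty `I` and `0` otherwise, and
`y j * (1 - ∑ i, x i * y i) = 0`. -/
lemma trace_mul_one_sub (hn : (n : K) = 1) (b : CohnAlgebra K n) :
    trace K n (b * (1 - ∑ i, x K i * y K i)) = 0 := by
  suffices trace K n ∘ₗ LinearMap.mulRight K (1 - ∑ i, x K i * y K i) = 0 from
    LinearMap.congr_fun this b
  refine linearMap_ext K fun I J => ?_
  simp only [LinearMap.comp_apply, LinearMap.mulRight_apply, LinearMap.zero_apply]
  cases J with
  | nil =>
    have h (i : Fin n) : trace K n (wordX (x K) I * (x K i * y K i)) = if I = [] then 1 else 0 := by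
      have := trace_wordX_mul_wordY K (I ++ [i]) [i]
      simpa [wordX_append, wordX_cons, wordY_cons, mul_assoc] using this
    have h' := trace_wordX_mul_wordY K I []
    rw [wordY_nil, mul_one] at h'
    rw [wordY_nil, mul_one, mul_sub, mul_one, map_sub, Finset.mul_sum, map_sum, h',
      Finset.sum_congr rfl fun i _ => h i]
    simp [hn]
  | cons j J =>
    have : y K j * (1 - ∑ i, x K i * y K i) = 0 := by
      rw [mul_sub, mul_one, Finset.mul_sum]
      simp [← mul_assoc, y_mul_x]
    rw [wordY_cons, mul_assoc, mul_assoc, this]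
    simp

lemma trace_eq_zero_of_mem (hn : (n : K) = 1) {a : CohnAlgebra K n} (ha : a ∈ leavittIdeal K n) :
    trace K n a = 0 := by
  -- The radical of the form `(a, b) ↦ trace (a * b)` is a two-sided ideal.
  let R : TwoSidedIdeal (CohnAlgebra K n) := .mk' {a | ∀ b, trace K n (b * a) = 0}
    (by simp)
    (fun {a a'} ha ha' b => by rw [mul_add, map_add, ha, ha', add_zero])
    (fun {a} ha b => by rw [mul_neg, map_neg, ha, neg_zero])
    (fun {a a'} ha b => by rw [← mul_assoc, ha])
    (fun {a a'} ha b => by rw [← mul_assoc, trace_mul_comm, ← mul_assoc, ha])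
  have hle : leavittIdeal K n ≤ R := by
    refine TwoSidedIdeal.span_le.2 ?_
    rintro _ rfl
    rw [SetLike.mem_coe, TwoSidedIdeal.mem_mk']
    exact trace_mul_one_sub K hn
  have := hle ha
  rw [TwoSidedIdeal.mem_mk'] at this
  simpa using this 1

end CohnAlgebra

namespace LeavittAlgebra

variable (K : Type*) [Field K] (n : ℕ)

/-- The quotient map from the Cohn algebra onto the Leavitt algebra. -/
def mk : CohnAlgebra K n →ₐ[K] LeavittAlgebra K n where
  toRingHom := (CohnAlgebra.leavittIdeal K n).ringCon.mk'
  commutes' _ := rfl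

lemma mk_surjective : Function.Surjective (mk K n) :=
  (CohnAlgebra.leavittIdeal K n).ringCon.mk'_surjective

lemma mk_eq_mk_iff {a b : CohnAlgebra K n} :
    mk K n a = mk K n b ↔ a - b ∈ CohnAlgebra.leavittIdeal K n :=
  ((CohnAlgebra.leavittIdeal K n).ringCon.eq).trans (TwoSidedIdeal.rel_iff _ a b)

lemma leavittFamily :
    LeavittFamily (fun i : Fin n => mk K n (.x K i)) (fun i : Fin n => mk K n (.y K i)) where
  mul_eq i j := by
    rw [← map_mul, CohnAlgebra.y_mul_x]
    split_ifs <;> simp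
  sum_eq := by
    simp only [← map_mul, ← map_sum]
    rw [← map_one (mk K n), eq_comm, mk_eq_mk_iff]
    exact TwoSidedIdeal.subset_span rfl

lemma adjoin_eq_top : Algebra.adjoin K
    (Set.range (fun i : Fin n => mk K n (.x K i)) ∪ Set.range fun i => mk K n (.y K i)) = ⊤ := by
  have h := congrArg (Subalgebra.map (mk K n)) (CohnAlgebra.adjoin_eq_top K (n := n))
  rw [AlgHom.map_adjoin, Algebra.map_top, (AlgHom.range_eq_top _).2 (mk_surjective K n),
    Set.image_union, ← Set.range_comp, ← Set.range_comp] at h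
  exact h

/-- When `n = 1` in `K`, the Leavitt algebra has a trace normalized at `1`. -/
lemma exists_trace (hn : (n : K) = 1) : ∃ t : LeavittAlgebra K n →ₗ[K] K,
    t 1 = 1 ∧ ∀ a b, t (a * b) = t (b * a) := by
  have hker : LinearMap.ker (mk K n).toLinearMap ≤ LinearMap.ker (CohnAlgebra.trace K n) := by
    intro a ha
    refine CohnAlgebra.trace_eq_zero_of_mem K hn ?_
    rw [← sub_zero a, ← mk_eq_mk_iff, map_zero]
    exact ha
  obtain ⟨t, ht⟩ : ∃ t : LeavittAlgebra K n →ₗ[K] K,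
      ∀ a, t (mk K n a) = CohnAlgebra.trace K n a := by
    let e := (mk K n).toLinearMap.quotKerEquivOfSurjective (mk_surjective K n)
    refine ⟨(LinearMap.ker (mk K n).toLinearMap).liftQ _ hker ∘ₗ e.symm.toLinearMap, fun a => ?_⟩
    have : e.symm (mk K n a) = Submodule.Quotient.mk a := by
      rw [LinearEquiv.symm_apply_eq]; rfl
    simp [this]
  refine ⟨t, ?_, fun a b => ?_⟩
  · rw [← map_one (mk K n), ht, CohnAlgebra.trace_one]
  · obtain ⟨a, rfl⟩ := mk_surjective K n a
    obtain ⟨b, rfl⟩ := mk_surjective K n b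
    rw [← map_mul, ← map_mul, ht, ht, CohnAlgebra.trace_mul_comm]

end LeavittAlgebra

/-! ### Commutators of an associative algebra -/

section Commutator

variable {K S : Type*} [Field K] [Ring S] [Algebra K S]

lemma lie_mem_commutatorLie (a b : S) : ⁅a, b⁆ ∈ commutatorLie K S :=
  LieSubmodule.lie_mem_lie (LieSubmodule.mem_top _) (LieSubmodule.mem_top _)

/-- A linear subspace containing all brackets contains `[S⁻, S⁻]`. -/
lemma mem_of_mem_commutatorLie {N : Submodule K S} (hN : ∀ a b : S, ⁅a, b⁆ ∈ N) {c : S}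
    (hc : c ∈ commutatorLie K S) : c ∈ N := by
  rw [← LieSubmodule.mem_toSubmodule, LieSubmodule.lieIdeal_oper_eq_linear_span'] at hc
  refine Submodule.span_le.2 ?_ hc
  rintro _ ⟨a, -, b, -, rfl⟩
  exact hN a b

/-- If `1` is a sum of commutators, then `K ∙ 1` is a central ideal of `[S⁻, S⁻]`, so a simple
`[S⁻, S⁻]` would be abelian. -/
lemma one_notMem_commutatorLie_of_isSimple (h : LieAlgebra.IsSimple K (commutatorLie K S)) :
    (1 : S) ∉ commutatorLie K S := by
  intro h1
  let e : commutatorLie K S := ⟨1, h1⟩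
  have hcentral (c : K) (z : commutatorLie K S) : ⁅z, c • e⁆ = 0 := by
    apply Subtype.ext
    change ⁅(z : S), c • (1 : S)⁆ = 0
    simp [Ring.lie_def]
  let J : LieIdeal K (commutatorLie K S) :=
    { K ∙ e with
      lie_mem := by
        intro z m hm
        obtain ⟨c, rfl⟩ := Submodule.mem_span_singleton.1 hm
        rw [hcentral]
        exact (K ∙ e).zero_mem }
  have hmem (z : commutatorLie K S) : z ∈ J ↔ ∃ c : K, c • e = z := Submodule.mem_span_singleton
  apply h.non_abelian
  rcases h.eq_bot_or_eq_top J with hJ | hJ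
  · have he : e = 0 := by
      have : e ∈ J := (hmem e).2 ⟨1, one_smul _ _⟩
      rwa [hJ, LieSubmodule.mem_bot] at this
    have : (1 : S) = 0 := congrArg Subtype.val he
    have := subsingleton_of_zero_eq_one this.symm
    exact ⟨fun z w => Subtype.ext (Subsingleton.elim _ _)⟩
  · refine ⟨fun z w => ?_⟩
    obtain ⟨c, rfl⟩ := (hmem w).1 (hJ ▸ LieSubmodule.mem_top w)
    exact hcentral c z

/-- A nonzero central element of a simple ring is invertible, and its inverse is again central. So
`[S⁻, S⁻]`, being stable under multiplication by central elements, contains `1` as soon as it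
contains a nonzero central element. -/
lemma one_mem_commutatorLie_of_central [IsSimpleRing S] {u : S} (hu : u ≠ 0)
    (hcomm : ∀ a, u * a = a * u) (hmem : u ∈ commutatorLie K S) : (1 : S) ∈ commutatorLie K S := by
  let N : TwoSidedIdeal S := .mk' {c | ∃ r, u * r = c}
    ⟨0, mul_zero u⟩
    (by rintro _ _ ⟨r, rfl⟩ ⟨s, rfl⟩; exact ⟨r + s, mul_add ..⟩)
    (by rintro _ ⟨r, rfl⟩; exact ⟨-r, mul_neg ..⟩)
    (by rintro b _ ⟨r, rfl⟩; exact ⟨b * r, by rw [← mul_assoc, hcomm, mul_assoc]⟩)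
    (by rintro _ b ⟨r, rfl⟩; exact ⟨r * b, (mul_assoc ..).symm⟩)
  obtain ⟨r, hr⟩ : ∃ r, u * r = 1 := by
    have := IsSimpleRing.one_mem_of_ne_zero_mem N hu
      ((TwoSidedIdeal.mem_mk' ..).2 ⟨1, mul_one u⟩)
    rwa [TwoSidedIdeal.mem_mk'] at this
  have hr' (a : S) : r * a = a * r := by
    calc r * a = r * a * (u * r) := by rw [hr, mul_one]
      _ = r * u * a * r := by rw [mul_assoc r u, hcomm a]; simp only [mul_assoc]
      _ = a * r := by rw [← hcomm, hr, one_mul]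
  have := mem_of_mem_commutatorLie (K := K)
    (N := (commutatorLie K S).toSubmodule.comap (LinearMap.mulRight K r)) (fun a b => by
      change ⁅a, b⁆ * r ∈ commutatorLie K S
      have : ⁅a, b⁆ * r = ⁅a, b * r⁆ := by
        rw [Ring.lie_def, Ring.lie_def, sub_mul, mul_assoc, mul_assoc b a, mul_assoc b r, hr']
      rw [this]
      exact lie_mem_commutatorLie _ _) hmem
  change u * r ∈ commutatorLie K S at this
  rwa [hr] at this

end Commutator

/-! ### Lie ideals in the presence of a Leavitt family -/

namespace LeavittFamily

variable {ι K S : Type*} [Fintype ι] [DecidableEq ι] [Field K] [Ring S] [Algebra K S] {x y : ι → S}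

lemma card_sub_one_mem_commutatorLie (h : LeavittFamily x y) :
    ((Fintype.card ι : S) - 1) ∈ commutatorLie K S := by
  have : (Fintype.card ι : S) - 1 = ∑ i, ⁅y i, x i⁆ := by
    simp [Ring.lie_def, h.mul_self, h.sum_eq, Finset.sum_sub_distrib]
  rw [this]
  exact sum_mem fun i _ => lie_mem_commutatorLie _ _

/-- The product rule of the matrix units `x i * a * y j`. -/
lemma unit_mul_unit (h : LeavittFamily x y) (i j k l : ι) (a b : S) :
    x i * a * y j * (x k * b * y l) = if j = k then x i * (a * b) * y l else 0 := by
  rw [mul_assoc, mul_assoc (x k), ← mul_assoc (y j), h.mul_eq]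
  split_ifs <;> simp [mul_assoc]

lemma unit_mem_commutatorLie (h : LeavittFamily x y) {i j : ι} (hij : i ≠ j) (a : S) :
    x i * a * y j ∈ commutatorLie K S := by
  have : x i * a * y j = ⁅x i * a * y j, x j * 1 * y j⁆ := by
    simp only [Ring.lie_def, h.unit_mul_unit]
    simp [hij.symm]
  rw [this]
  exact lie_mem_commutatorLie _ _

lemma eq_sum_units (h : LeavittFamily x y) (a : S) :
    a = ∑ i, ∑ j, x i * (y i * a * x j) * y j := by
  calc a = (∑ i, x i * y i) * a * (∑ j, x j * y j) := by rw [h.sum_eq, one_mul, mul_one]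
    _ = _ := by
      simp only [Finset.sum_mul, Finset.mul_sum, mul_assoc]
      exact Finset.sum_comm

lemma mul_mul (h : LeavittFamily x y) (i j : ι) (a : S) :
    y i * (x j * a) = if i = j then a else 0 := by
  rw [← mul_assoc, h.mul_eq]
  split_ifs <;> simp

/-- A subspace with `[U, [S⁻, S⁻]] ⊆ U` containing all off-diagonal matrix units contains
`[S⁻, S⁻]`. -/
lemma lie_mem_of_units_mem (h : LeavittFamily x y) [Nontrivial ι] {U : Submodule K S}
    (hU : ∀ u ∈ U, ∀ v ∈ commutatorLie K S, ⁅u, v⁆ ∈ U)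
    (hunit : ∀ i j, i ≠ j → ∀ a, x i * a * y j ∈ U) (a b : S) : ⁅a, b⁆ ∈ U := by
  have key (i j k l : ι) (a b : S) : ⁅x i * a * y j, x k * b * y l⁆ ∈ U := by
    by_cases hij : i = j <;> by_cases hkl : k = l
    · subst hij hkl
      by_cases hik : i = k
      · subst hik
        -- The diagonal entry `[a, b]` is a difference of two brackets of off-diagonal units.
        obtain ⟨j, hj⟩ := exists_ne i
        have e : ⁅x i * a * y i, x i * b * y i⁆ = ⁅x i * a * y j, x j * b * y i⁆
            - ⁅x i * 1 * y j, x j * (b * a) * y i⁆ := by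
          simp only [Ring.lie_def, h.unit_mul_unit, if_true]
          simp only [one_mul, mul_one]
          abel
        rw [e]
        exact sub_mem
          (hU _ (hunit _ _ hj.symm _) _ (h.unit_mem_commutatorLie hj _))
          (hU _ (hunit _ _ hj.symm _) _ (h.unit_mem_commutatorLie hj _))
      · simp [Ring.lie_def, h.unit_mul_unit, hik, Ne.symm hik]
    · rw [← lie_skew, Ring.lie_def, h.unit_mul_unit, h.unit_mul_unit]
      subst hij
      refine neg_mem (sub_mem ?_ ?_) <;> split_ifs with h'
      · subst h'; exact hunit _ _ hkl _
      · exact zero_mem _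
      · subst h'; exact hunit _ _ hkl _
      · exact zero_mem _
    · rw [Ring.lie_def, h.unit_mul_unit, h.unit_mul_unit]
      subst hkl
      refine sub_mem ?_ ?_ <;> split_ifs with h'
      · subst h'; exact hunit _ _ hij _
      · exact zero_mem _
      · subst h'; exact hunit _ _ hij _
      · exact zero_mem _
    · exact hU _ (hunit _ _ hij _) _ (h.unit_mem_commutatorLie hkl _)
  rw [h.eq_sum_units a, h.eq_sum_units b]
  simp only [sum_lie, lie_sum]
  exact sum_mem fun i _ => sum_mem fun j _ => sum_mem fun k _ => sum_mem fun l _ => key ..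

/-- The off-diagonal matrix units in a Lie ideal are all or nothing when `S` is simple. -/
lemma units_mem_of_unit_mem (h : LeavittFamily x y) [IsSimpleRing S] (hι : 3 ≤ Fintype.card ι)
    {U : Submodule K S} (hU : ∀ u ∈ U, ∀ v ∈ commutatorLie K S, ⁅u, v⁆ ∈ U)
    {p t : ι} (hpt : p ≠ t) {a : S} (ha : a ≠ 0) (hmem : x p * a * y t ∈ U) {i j : ι}
    (hij : i ≠ j) (b : S) : x i * b * y j ∈ U := by
  have hthird (i j : ι) : ∃ k, k ≠ i ∧ k ≠ j := by
    obtain ⟨k, -, hk⟩ := Finset.exists_mem_notMem_of_card_lt_card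
      (s := {i, j}) (t := (Finset.univ : Finset ι)) (Finset.card_le_two.trans_lt hι)
    exact ⟨k, by simpa using hk⟩
  have hright {p t j : ι} {c : S} (b : S) (hpt : p ≠ t) (hjp : j ≠ p) (hjt : j ≠ t)
      (hc : x p * c * y t ∈ U) : x p * (c * b) * y j ∈ U := by
    have := hU _ hc _ (h.unit_mem_commutatorLie hjt.symm b)
    rwa [Ring.lie_def, h.unit_mul_unit, h.unit_mul_unit, if_pos rfl, if_neg hjp, sub_zero] at this
  have hleft {p i j : ι} {c : S} (b : S) (hpj : p ≠ j) (hij : i ≠ j) (hip : i ≠ p)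
      (hc : x p * c * y j ∈ U) : x i * (b * c) * y j ∈ U := by
    have := hU _ hc _ (h.unit_mem_commutatorLie hip b)
    rw [Ring.lie_def, h.unit_mul_unit, h.unit_mul_unit, if_pos rfl, if_neg hij.symm,
      zero_sub] at this
    exact neg_mem_iff.1 this
  let N : TwoSidedIdeal S := .mk' {c | ∀ i j, i ≠ j → x i * c * y j ∈ U}
    (by simp)
    (fun {c d} hc hd i j hij => by
      rw [mul_add, add_mul]; exact add_mem (hc i j hij) (hd i j hij))
    (fun {c} hc i j hij => by
      rw [mul_neg, neg_mul]; exact neg_mem (hc i j hij))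
    (fun {b c} hc i j hij => by
      obtain ⟨k, hki, hkj⟩ := hthird i j
      exact hleft b hkj hij hki.symm (hc k j hkj))
    (fun {c b} hc i j hij => by
      obtain ⟨k, hki, hkj⟩ := hthird i j
      exact hright b hki.symm hij.symm hkj.symm (hc i k hki.symm))
  have hrow {j : ι} (hj : j ≠ p) : x p * a * y j ∈ U := by
    by_cases hjt : j = t
    · rwa [hjt]
    · simpa using hright 1 hpt hj hjt hmem
  have hrows {i j : ι} (hij : i ≠ j) (hj : j ≠ p) : x i * a * y j ∈ U := by
    by_cases hip : i = p
    · rw [hip]; exact hrow hj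
    · simpa using hleft 1 hj.symm hij hip (hrow hj)
  have haN : a ∈ N := by
    rw [TwoSidedIdeal.mem_mk']
    intro i j hij
    by_cases hj : j = p
    · obtain ⟨k, hki, hkj⟩ := hthird i j
      simpa using hright 1 hki.symm hij.symm hkj.symm (hrows hki.symm (hj ▸ hkj))
    · exact hrows hij hj
  have hb : b ∈ N := by
    simpa using N.mul_mem_left b 1 (IsSimpleRing.one_mem_of_ne_zero_mem N ha haN)
  rw [TwoSidedIdeal.mem_mk'] at hb
  exact hb i j hij

/-- A nonzero Lie ideal of `[S⁻, S⁻]` contains a nonzero off-diagonal matrix unit, unless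
`[S⁻, S⁻]` contains `1`. -/
lemma exists_unit_mem (h : LeavittFamily x y) [IsSimpleRing S] (hι : 4 ≤ Fintype.card ι)
    (h1 : (1 : S) ∉ commutatorLie K S)
    {U : Submodule K S} (hU : ∀ u ∈ U, ∀ v ∈ commutatorLie K S, ⁅u, v⁆ ∈ U)
    {u : S} (hu : u ∈ U) (hu0 : u ≠ 0) (hu' : u ∈ commutatorLie K S) :
    ∃ p t a, p ≠ t ∧ a ≠ 0 ∧ x p * a * y t ∈ U := by
  by_cases hoff : ∃ p q, q ≠ p ∧ y q * u * x p ≠ 0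
  · obtain ⟨p, q, hqp, hne⟩ := hoff
    obtain ⟨s, -, hs⟩ := Finset.exists_mem_notMem_of_card_lt_card
      (s := {p, q}) (t := (Finset.univ : Finset ι)) (Finset.card_le_two.trans_lt (by
        rw [Finset.card_univ]; omega))
    obtain ⟨t, -, ht⟩ := Finset.exists_mem_notMem_of_card_lt_card
      (s := {p, q, s}) (t := (Finset.univ : Finset ι)) (Finset.card_le_three.trans_lt hι)
    simp only [Finset.mem_insert, Finset.mem_singleton, not_or] at hs ht
    obtain ⟨hsp, hsq⟩ := hs
    obtain ⟨htp, htq, hts⟩ := ht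
    refine ⟨p, t, y q * u * x p, Ne.symm htp, hne, ?_⟩
    -- Three successive brackets move the entry of `u` at `(q, p)` to the position `(p, t)` and
    -- annihilate all other entries.
    have hb := hU _ (hU _ (hU _ hu _ (h.unit_mem_commutatorLie hqp.symm 1)) _
      (h.unit_mem_commutatorLie (Ne.symm hsp) 1)) _ (h.unit_mem_commutatorLie (Ne.symm hts) 1)
    have e : ⁅⁅⁅u, x p * 1 * y q⁆, x p * 1 * y s⁆, x s * 1 * y t⁆
        = -(x p * (y q * u * x p) * y t) := by
      simp [Ring.lie_def, sub_mul, mul_sub, mul_assoc, h.mul_mul, hqp, hsp, Ne.symm hsq, htp]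
    rw [e] at hb
    exact neg_mem_iff.1 hb
  push Not at hoff
  have hux (p : ι) : u * x p = x p * (y p * u * x p) := by
    refine h.ext_left fun i => ?_
    rw [h.mul_mul, ← mul_assoc]
    split_ifs with hip
    · rw [hip]
    · exact hoff p i hip
  have hyu (q : ι) : y q * u = y q * u * x q * y q := by
    refine h.ext_right fun i => ?_
    rw [mul_assoc _ (y q), h.mul_eq]
    split_ifs with hqi
    · rw [hqi, mul_one]
    · rw [mul_zero, hoff i q hqi]
  by_cases hdiag : ∃ p q a, p ≠ q ∧ y p * u * x p * a - a * (y q * u * x q) ≠ 0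
  · obtain ⟨p, q, a, hpq, hne⟩ := hdiag
    refine ⟨p, q, _, hpq, hne, ?_⟩
    have hb := hU _ hu _ (h.unit_mem_commutatorLie hpq a)
    have e : ⁅u, x p * a * y q⁆ = x p * (y p * u * x p * a - a * (y q * u * x q)) * y q := by
      calc ⁅u, x p * a * y q⁆ = u * x p * a * y q - x p * a * (y q * u) := by
            simp only [Ring.lie_def, mul_assoc]
        _ = _ := by
            rw [hux]
            nth_rw 2 [hyu]
            simp only [mul_sub, sub_mul, mul_assoc]
    rwa [e] at hb
  -- All diagonal entries agree with one central element, so `u` itself is central.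
  push Not at hdiag
  exfalso
  have : Nontrivial ι := Fintype.one_lt_card_iff_nontrivial.1 (by omega)
  obtain ⟨p₀, q₀, hpq⟩ := exists_pair_ne ι
  set c := y p₀ * u * x p₀ with hc
  have hdiag' (p : ι) : y p * u * x p = c := by
    by_cases hp : p = p₀
    · rw [hp]
    · simpa [sub_eq_zero] using hdiag p p₀ 1 hp
  have hcentral (a : S) : c * a = a * c := by
    have := hdiag p₀ q₀ a hpq
    rwa [hdiag', hdiag', sub_eq_zero] at this
  have huc : u = c := h.ext_right fun p => by rw [hux, hdiag', hcentral]
  exact h1 (one_mem_commutatorLie_of_central hu0 (huc ▸ hcentral) hu')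

/-- If a simple algebra contains a Leavitt family with at least four members and `1` is not a sum of
commutators, then `[S⁻, S⁻]` is a simple Lie algebra. -/
theorem isSimple_commutatorLie (h : LeavittFamily x y) [IsSimpleRing S]
    (hι : 4 ≤ Fintype.card ι) (h1 : (1 : S) ∉ commutatorLie K S) :
    LieAlgebra.IsSimple K (commutatorLie K S) where
  eq_bot_or_eq_top I := by
    refine or_iff_not_imp_left.2 fun hI => ?_
    let U : Submodule K S := I.toSubmodule.map (commutatorLie K S).toSubmodule.subtype
    have hU : ∀ u ∈ U, ∀ v ∈ commutatorLie K S, ⁅u, v⁆ ∈ U := by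
      rintro _ ⟨u, hu, rfl⟩ v hv
      let v' : commutatorLie K S := ⟨v, hv⟩
      exact ⟨_, lie_mem_left K (commutatorLie K S) I u v' hu, rfl⟩
    obtain ⟨u, hu, hu0⟩ : ∃ u ∈ I, u ≠ 0 := by
      by_contra! h0
      exact hI ((LieSubmodule.eq_bot_iff I).2 h0)
    obtain ⟨p, t, a, hpt, ha, hmem⟩ := h.exists_unit_mem hι h1 hU (u := u) ⟨u, hu, rfl⟩
      (fun h0 => hu0 (Subtype.ext h0)) u.2
    have hunit : ∀ i j, i ≠ j → ∀ a, x i * a * y j ∈ U := fun i j hij b =>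
      h.units_mem_of_unit_mem (by omega) hU hpt ha hmem hij b
    have : Nontrivial ι := ⟨p, t, hpt⟩
    refine eq_top_iff.2 fun v _ => ?_
    obtain ⟨w, hw, hwv⟩ := mem_of_mem_commutatorLie (h.lie_mem_of_units_mem hU hunit) v.2
    have : w = v := Subtype.ext hwv
    exact this ▸ hw
  non_abelian habel := by
    have : Nontrivial ι := Fintype.one_lt_card_iff_nontrivial.1 (by omega)
    obtain ⟨i, j, hij⟩ := exists_pair_ne ι
    have e : ⁅x i * 1 * y j, x j * 1 * y i⁆ = 0 := congrArg Subtype.val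
      (habel.trivial ⟨_, h.unit_mem_commutatorLie (K := K) hij 1⟩
        ⟨_, h.unit_mem_commutatorLie hij.symm 1⟩)
    have e' : y i * ⁅x i * 1 * y j, x j * 1 * y i⁆ * x i = 1 := by
      simp [Ring.lie_def, mul_sub, mul_assoc, h.mul_mul, h.mul_self, hij]
    rw [e] at e'
    simp at e'

end LeavittFamily

/-! ### Matrices over the Leavitt algebra -/

section MatrixCommutator

variable {K A : Type*} [Field K] [Ring A] [Algebra K A]

/-- Composing a trace on `A` with the matrix trace gives a functional vanishing on commutators; it
takes the value `d` at the identity matrix. -/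
lemma one_notMem_commutatorLie_matrix {d : ℕ} (hd : (d : K) ≠ 0) {t : A →ₗ[K] K} (h1 : t 1 = 1)
    (ht : ∀ a b, t (a * b) = t (b * a)) :
    (1 : Matrix (Fin d) (Fin d) A) ∉ commutatorLie K (Matrix (Fin d) (Fin d) A) := by
  intro hmem
  have := mem_of_mem_commutatorLie (K := K)
    (N := LinearMap.ker (t ∘ₗ Matrix.traceLinearMap (Fin d) K A)) (fun M N => by
      rw [LinearMap.mem_ker, LinearMap.comp_apply, Matrix.traceLinearMap_apply, Ring.lie_def,
        Matrix.trace_sub, map_sub, sub_eq_zero]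
      simp only [Matrix.trace, Matrix.diag_apply, Matrix.mul_apply, map_sum]
      rw [Finset.sum_comm]
      simp only [ht]) hmem
  have hcast : t (d : A) = d := by
    rw [← nsmul_one d, map_nsmul, h1, nsmul_one]
  simp [hcast] at this
  exact hd this

/-- The identity matrix is congruent to `d` times a diagonal matrix unit modulo commutators. -/
lemma one_mem_commutatorLie_matrix {d : ℕ} (hd : 1 ≤ d) (hK : (d : K) = 0) :
    (1 : Matrix (Fin d) (Fin d) A) ∈ commutatorLie K (Matrix (Fin d) (Fin d) A) := by
  have i₀ : Fin d := ⟨0, hd⟩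
  have e : (1 : Matrix (Fin d) (Fin d) A)
      = ∑ i, ⁅Matrix.single i i₀ (1 : A), Matrix.single i₀ i (1 : A)⁆ := by
    simp only [Ring.lie_def, Matrix.single_mul_single_same, mul_one, Finset.sum_sub_distrib,
      Finset.sum_const, Finset.card_univ, Fintype.card_fin]
    rw [Matrix.sum_single_one, ← Nat.cast_smul_eq_nsmul K, hK, zero_smul, sub_zero]
  rw [e]
  exact sum_mem fun i _ => lie_mem_commutatorLie _ _

end MatrixCommutator

theorem theorem3p5 (K : Type*) [Field K] (n d : ℕ) (hn : 2 ≤ n) (hd : 1 ≤ d) :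
    LieAlgebra.IsSimple K (commutatorLie K (Matrix (Fin d) (Fin d) (LeavittAlgebra K n))) ↔
      ringChar K ∣ n - 1 ∧ ¬ ringChar K ∣ d := by
  have hS := (LeavittAlgebra.leavittFamily K n).map
    (Matrix.scalar (Fin d) (α := LeavittAlgebra K n))
  rw [← ringChar.spec, ← ringChar.spec, Nat.cast_sub (by omega), Nat.cast_one]
  constructor
  · intro h
    have h1 := one_notMem_commutatorLie_of_isSimple h
    refine ⟨?_, fun hd0 => h1 (one_mem_commutatorLie_matrix hd hd0)⟩
    by_contra hne
    refine h1 ?_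
    have hmem := hS.card_sub_one_mem_commutatorLie (K := K)
    have := (commutatorLie K (Matrix (Fin d) (Fin d) (LeavittAlgebra K n))).smul_mem
      ((n : K) - 1)⁻¹ hmem
    have e : ((Fintype.card (Fin n) : Matrix (Fin d) (Fin d) (LeavittAlgebra K n)) - 1)
        = ((n : K) - 1) • 1 := by
      rw [Fintype.card_fin, sub_smul, one_smul, Nat.cast_smul_eq_nsmul, nsmul_one]
    rw [e, smul_smul, inv_mul_cancel₀ hne, one_smul] at this
    exact this
  · rintro ⟨hn1, hd0⟩
    obtain ⟨t, ht1, ht⟩ := LeavittAlgebra.exists_trace K n (sub_eq_zero.1 hn1)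
    have : Nontrivial (LeavittAlgebra K n) := ⟨1, 0, fun h0 => by simp [h0] at ht1⟩
    have : Nontrivial (Fin n) := Fin.nontrivial_iff_two_le.2 hn
    have : Nonempty (Fin d) := ⟨⟨0, hd⟩⟩
    have := (LeavittAlgebra.leavittFamily K n).isSimpleRing (LeavittAlgebra.adjoin_eq_top K n)
    exact hS.prod.isSimple_commutatorLie (by simp; nlinarith)
      (one_notMem_commutatorLie_matrix hd0 ht1 ht)
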